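/- **Theorem.** Consider an adversarial $d$-armed bandit game over $T$ rounds with an oblivious adversary: the loss vectors $\boldsymbol g_1,\dots,\boldsymbol g_T\in\mathbb R^d$ are fixed before the game, with $g_{t,i}\in[0,L_\infty]$ for all $t,i$. Let $V=\{\boldsymbol x\in\mathbb R^d: x_i\ge 0,\ \sum_{i=1}^d x_i=1\}$ and $\eta>0$. The INF algorithm (Online Mirror Descent with the Tsallis entropy with parameter $q=1/2$) starts with $\boldsymbol x_1=[1/d,\dots,1/d]$ and in each round $t=1,\dots,T$ draws an arm $A_t$ with $P(A_t=i\mid A_1,\dots,A_{t-1})=x_{t,i}$, observes only the loss $g_{t,A_t}$ and pays it, forms the importance-weighted estimate $\tilde g_{t,i}=g_{t,i}/x_{t,i}$ if $i=A_t$ and $\tilde g_{t,i}=0$ otherwise, and sets $$\boldsymbol x_{t+1}=\mathop{\mathrm{argmin}}_{\boldsymbol x\in V}\ \eta\langle\tilde{\boldsymbol g}_t,\boldsymbol x\rangle-\frac{1}{1-q}\sum_{i=1}^d x_i^{q}+\frac{q}{1-q}\sum_{i=1}^d x_{t,i}^{q-1}x_i,\qquad q=\tfrac12 .$$ Then for every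 $\boldsymbol u\in V$ $$\mathbb E\Big[\sum_{t=1}^T g_{t,A_t}\Big]-\sum_{t=1}^T\langle\boldsymbol g_t,\boldsymbol u\rangle\ \le\ \frac{2\sqrt d}{\eta}+\eta\sqrt d\,L_\infty^2\,T .$$ In particular, if $L_\infty>0$, $T\ge1$ and $\eta=\dfrac{c}{L_\infty\sqrt T}$ for a constant $c>0$, then the left-hand side is at most $\left(\frac2c+c\right)L_\infty\sqrt{dT}=O(L_\infty\sqrt{dT})$. -/

import Mathlib

open MeasureTheory ProbabilityTheory
open scoped ProbabilityTheory

/-! Rounds are numbered from `0`: round `t` of the code is round `t + 1` of the text, and the `T`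
rounds of the game are `0, …, T - 1`. Arms are the elements of `Fin d`. -/

noncomputable section

namespace INF

variable {d : ℕ}

/-- The importance-weighted estimate of the loss vector, built from the sampling distribution `x`,
the pulled arm `a` and the single observed loss `l` of that arm. -/
def lossEstimate (x : Fin d → ℝ) (a : Fin d) (l : ℝ) : Fin d → ℝ :=
  fun i => if i = a then l / x i else 0

/-- The objective minimised in one round, as a function of `y`:
`η ⟨γ, y⟩ - 1/(1-q) ∑ᵢ yᵢ^q + q/(1-q) ∑ᵢ xᵢ^(q-1) yᵢ`. Up to a constant in `y` this is
`η ⟨γ, y⟩ + B(y; x)` with `B` the Bregman divergence of the negative Tsallis entropy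
`ψ(y) = 1/(1-q) (1 - ∑ᵢ yᵢ^q)`. -/
def objective (q η : ℝ) (x γ y : Fin d → ℝ) : ℝ :=
  η * ∑ i, γ i * y i - 1 / (1 - q) * ∑ i, y i ^ q + q / (1 - q) * ∑ i, x i ^ (q - 1) * y i

/-- `y` is a minimiser of the objective over the probability simplex. -/
def IsUpdate (q η : ℝ) (x γ y : Fin d → ℝ) : Prop :=
  y ∈ stdSimplex ℝ (Fin d) ∧ IsMinOn (objective q η x γ) (stdSimplex ℝ (Fin d)) y

/-- One step of mirror descent: the argmin of the objective over the probability simplex. -/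
def update (q η : ℝ) (x γ : Fin d → ℝ) : Fin d → ℝ :=
  Classical.epsilon (IsUpdate q η x γ)

/-- The argmin is attained. -/
theorem update_spec (hd : 0 < d) {q : ℝ} (hq : 0 ≤ q) (η : ℝ) (x γ : Fin d → ℝ) :
    IsUpdate q η x γ (update q η x γ) := by
  apply Classical.epsilon_spec (p := IsUpdate q η x γ)
  have hc : Continuous (objective q η x γ) := by
    unfold objective
    have h : ∀ i : Fin d, Continuous fun y : Fin d → ℝ => y i ^ q :=
      fun i => (continuous_apply i).rpow_const (fun _ => Or.inr hq)
    fun_prop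
  obtain ⟨y, hy, hmin⟩ := (isCompact_stdSimplex ℝ (Fin d)).exists_isMinOn
    ⟨_, single_mem_stdSimplex ℝ (⟨0, hd⟩ : Fin d)⟩ hc.continuousOn
  exact ⟨y, hy, hmin⟩

/-- The distribution over the arms used by the algorithm in round `t`, when the losses are `g` and
the arms pulled so far are `a 0, …, a (t - 1)` (later values of `a` are not used, and of `g` only
the observed entries `g s (a s)`, `s < t`, are). -/
def predict (q η : ℝ) (g : ℕ → Fin d → ℝ) (a : ℕ → Fin d) : ℕ → Fin d → ℝ
  | 0 => fun _ => 1 / (d : ℝ)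
  | t + 1 => update q η (predict q η g a t)
      (lossEstimate (predict q η g a t) (a t) (g t (a t)))

variable {Ω : Type*} [MeasurableSpace Ω]

/-- The σ-algebra generated by the arms pulled before round `t`. -/
abbrev past (A : ℕ → Ω → Fin d) (t : ℕ) : MeasurableSpace Ω :=
  ⨆ s ∈ Finset.range t, MeasurableSpace.comap (A s) inferInstance

/-- `A` is the random sequence of arms pulled by the algorithm during `T` rounds: in each round,
conditionally on the arms pulled before, the next arm is drawn from the current prediction. -/
structure IsRun (μ : Measure Ω) (q η : ℝ) (g : ℕ → Fin d → ℝ) (T : ℕ)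
    (A : ℕ → Ω → Fin d) : Prop where
  measurable : ∀ t < T, Measurable (A t)
  draw : ∀ t < T, ∀ i : Fin d,
    μ⟦A t ⁻¹' {i} | past A t⟧ =ᵐ[μ] fun ω => predict q η g (fun s => A s ω) t i

/-- The expected regret after `T` rounds against the fixed comparator `u`. -/
def expectedRegret (μ : Measure Ω) (g : ℕ → Fin d → ℝ) (T : ℕ) (A : ℕ → Ω → Fin d)
    (u : Fin d → ℝ) : ℝ :=
  (∫ ω, ∑ t ∈ Finset.range T, g t (A t ω) ∂μ) - ∑ t ∈ Finset.range T, ∑ i, g t i * u i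

end INF

end

/-!
With `q = 1/2` and `s = √x`, `v = √y`, the Bregman divergence of the negative Tsallis entropy is
`B(y; x) = ∑ᵢ (vᵢ - sᵢ)² / sᵢ`, so the usual mirror descent analysis reduces to algebra of square
roots.

*One round.* The minimiser `y` of the objective has positive coordinates
(`IsUpdate.pos`: the slope of `√` at `0` is infinite), hence satisfies the first-order condition
(`IsUpdate.firstOrder`). Together with the three-point identity for `B` this gives
`η ⟨γ, x - u⟩ ≤ B(u; x) - B(u; y) + (η ⟨γ, x - y⟩ - B(y; x))`, and completing the square in each
coordinate bounds the last bracket by `η² ∑ᵢ γᵢ² xᵢ^(3/2)`. For the importance-weighted estimate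
this is `η² l² / √xₐ`, where `a` is the pulled arm and `l` its loss.

*All rounds.* Telescoping, with `B(u; x₁) ≤ 2 √d` for the uniform `x₁`, yields a regret bound valid
for every sequence of arms (`sum_loss_le`). Predictions depend only on the finitely many past
arms, so conditioning on the past replaces the drawn arm by its conditional law
(`IsRun.integral_eq`): the linear term becomes `⟨g, u⟩`, and the second-order one becomes
`η ∑ᵢ gᵢ² √xᵢ ≤ η L² √d` by the Cauchy-Schwarz inequality.
-/

noncomputable section

namespace INF

variable {d : ℕ}

/-! ### The Bregman divergence and the mirror descent step for `q = 1/2` -/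

/-- The Bregman divergence of `-2 ∑ᵢ √xᵢ`, written as a weighted sum of squares. -/
def bregman (y x : Fin d → ℝ) : ℝ :=
  ∑ i, (√(y i) - √(x i)) ^ 2 / √(x i)

theorem bregman_nonneg (y x : Fin d → ℝ) : 0 ≤ bregman y x :=
  Finset.sum_nonneg fun _ _ => by positivity

theorem objective_half (η : ℝ) {x : Fin d → ℝ} (hx : ∀ i, 0 < x i) (γ y : Fin d → ℝ) :
    objective (1 / 2) η x γ y = ∑ i, ((η * γ i + 1 / √(x i)) * y i - 2 * √(y i)) := by
  have h : ∀ i, x i ^ ((1 : ℝ) / 2 - 1) = 1 / √(x i) := fun i => by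
    rw [show (1 : ℝ) / 2 - 1 = -(1 / 2) by norm_num, Real.rpow_neg (hx i).le,
      ← Real.sqrt_eq_rpow, one_div]
  simp only [objective, h, ← Real.sqrt_eq_rpow, Finset.mul_sum]
  rw [← Finset.sum_sub_distrib, ← Finset.sum_add_distrib]
  refine Finset.sum_congr rfl fun i _ => ?_
  ring

/-- A minimiser of the objective lies in the interior of the simplex: moving from a boundary point
by `ε` towards the interior point `x` changes the objective by at most `C ε - 2 √(ε xᵢ)`. -/
theorem IsUpdate.pos {η : ℝ} {x γ y : Fin d → ℝ} (hx : ∀ i, 0 < x i)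
    (hxs : x ∈ stdSimplex ℝ (Fin d)) (h : IsUpdate (1 / 2) η x γ y) (i : Fin d) : 0 < y i := by
  obtain ⟨hy, hmin⟩ := h
  by_contra hne
  have hyi : y i = 0 := le_antisymm (not_lt.mp hne) (hy.1 i)
  set w : Fin d → ℝ := fun j => η * γ j + 1 / √(x j)
  set C : ℝ := ∑ j, (w j * (x j - y j) + 2 * √(y j))
  have key : ∀ ε : ℝ, 0 < ε → ε ≤ 1 → 2 * √(ε * x i) ≤ ε * C := by
    intro ε h0 h1
    have hz : (fun j => (1 - ε) * y j + ε * x j) ∈ stdSimplex ℝ (Fin d) :=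
      (convex_stdSimplex ℝ (Fin d)) hy hxs (sub_nonneg.mpr h1) h0.le (by ring)
    have hle := isMinOn_iff.mp hmin _ hz
    rw [objective_half η hx, objective_half η hx] at hle
    have hterm : ∀ j, (w j * ((1 - ε) * y j + ε * x j) - 2 * √((1 - ε) * y j + ε * x j))
        ≤ (w j * y j - 2 * √(y j)) + ε * (w j * (x j - y j) + 2 * √(y j))
          - (if j = i then 2 * √(ε * x i) else 0) := by
      intro j
      split_ifs with hj
      · subst hj
        rw [hyi]
        simp only [mul_zero, zero_add, Real.sqrt_zero, sub_zero]
        linarith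
      · have hs : (1 - ε) * √(y j) ≤ √((1 - ε) * y j + ε * x j) := by
          apply Real.le_sqrt_of_sq_le
          rw [mul_pow, Real.sq_sqrt (hy.1 j)]
          nlinarith [mul_nonneg h0.le (hx j).le,
            mul_nonneg (mul_nonneg h0.le (sub_nonneg.mpr h1)) (hy.1 j)]
        linarith
    have hsum := Finset.sum_le_sum fun j (_ : j ∈ Finset.univ) => hterm j
    rw [Finset.sum_sub_distrib (g := fun j => if j = i then 2 * √(ε * x i) else 0),
      Finset.sum_add_distrib, ← Finset.mul_sum, Finset.sum_ite_eq' Finset.univ i] at hsum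
    simp only [Finset.mem_univ, if_true] at hsum
    linarith
  have hCpos : 0 < C := by
    have h1 := key 1 one_pos le_rfl
    have h2 : 0 < √(1 * x i) := Real.sqrt_pos.mpr (by linarith [hx i])
    linarith
  have hxi := hx i
  -- At `ε ≤ x i / C ^ 2` the inequality `4 ε x i ≤ ε² C²` fails.
  set ε := min 1 (x i / C ^ 2)
  have h0 : 0 < ε := lt_min one_pos (by positivity)
  have h1 := key ε h0 (min_le_left _ _)
  have h2 : ε * C ^ 2 ≤ x i := (le_div_iff₀ (by positivity)).mp (min_le_right _ _)
  have h3 : (2 * √(ε * x i)) ^ 2 ≤ (ε * C) ^ 2 := by gcongr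
  rw [mul_pow, Real.sq_sqrt (by positivity)] at h3
  nlinarith [mul_le_mul_of_nonneg_left h2 h0.le, mul_pos h0 hxi]

/-- The first-order optimality condition: the gradient of the objective at the minimiser is
nonnegative in every direction pointing into the simplex. -/
theorem IsUpdate.firstOrder {η : ℝ} {x γ y u : Fin d → ℝ} (hx : ∀ i, 0 < x i)
    (hxs : x ∈ stdSimplex ℝ (Fin d)) (h : IsUpdate (1 / 2) η x γ y)
    (hu : u ∈ stdSimplex ℝ (Fin d)) :
    0 ≤ ∑ i, (η * γ i + 1 / √(x i) - 1 / √(y i)) * (u i - y i) := by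
  have hypos := h.pos hx hxs
  obtain ⟨hy, hmin⟩ := h
  have hder : HasFDerivAt (objective (1 / 2) η x γ)
      (∑ i, ((η * γ i + 1 / √(x i)) • ContinuousLinearMap.proj (R := ℝ) (φ := fun _ => ℝ) i
        - (2 : ℝ) • ((1 / (2 * √(y i))) •
          ContinuousLinearMap.proj (R := ℝ) (φ := fun _ => ℝ) i))) y := by
    have he : objective (1 / 2) η x γ =
        fun z => ∑ i, ((η * γ i + 1 / √(x i)) * z i - 2 * √(z i)) :=
      funext fun z => objective_half η hx γ z
    rw [he]
    refine HasFDerivAt.fun_sum fun i _ => ?_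
    have hp : HasFDerivAt (fun z : Fin d → ℝ => z i)
      (ContinuousLinearMap.proj (R := ℝ) (φ := fun _ => ℝ) i) y := hasFDerivAt_apply i y
    exact (hp.const_mul _).sub ((hp.sqrt (hypos i).ne').const_mul 2)
  have hseg : segment ℝ y u ⊆ stdSimplex ℝ (Fin d) :=
    (convex_stdSimplex ℝ (Fin d)).segment_subset hy hu
  have hnn := hmin.localize.hasFDerivWithinAt_nonneg hder.hasFDerivWithinAt
    (sub_mem_posTangentConeAt_of_segment_subset hseg)
  refine hnn.trans_eq ?_
  rw [_root_.sum_apply]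
  refine Finset.sum_congr rfl fun i _ => ?_
  simp only [_root_.sub_apply, _root_.smul_apply,
    ContinuousLinearMap.proj_apply, smul_eq_mul, Pi.sub_apply]
  have := (Real.sqrt_pos.mpr (hypos i)).ne'
  field_simp

/-- The regret of one round of mirror descent against a nonnegative linear loss `γ`. -/
theorem IsUpdate.regret_le {η : ℝ} (hη : 0 < η) {x γ y u : Fin d → ℝ} (hx : ∀ i, 0 < x i)
    (hxs : x ∈ stdSimplex ℝ (Fin d)) (hγ : ∀ i, 0 ≤ γ i) (h : IsUpdate (1 / 2) η x γ y)
    (hu : u ∈ stdSimplex ℝ (Fin d)) :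
    η * ∑ i, γ i * (x i - u i) + bregman u y ≤
      bregman u x + η ^ 2 * ∑ i, γ i ^ 2 * (x i * √(x i)) := by
  have hfo := h.firstOrder hx hxs hu
  have hypos := h.pos hx hxs
  have hterm : ∀ i, η * (γ i * (x i - u i)) + (√(u i) - √(y i)) ^ 2 / √(y i)
      + (η * γ i + 1 / √(x i) - 1 / √(y i)) * (u i - y i) ≤
      (√(u i) - √(x i)) ^ 2 / √(x i) + η ^ 2 * (γ i ^ 2 * (x i * √(x i))) := by
    intro i
    have hu2 := Real.sq_sqrt (hu.1 i)
    have hx2 := Real.sq_sqrt (hx i).le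
    have hy2 := Real.sq_sqrt (hypos i).le
    have ha := Real.sqrt_pos.mpr (hx i)
    have hb := Real.sqrt_pos.mpr (hypos i)
    generalize √(u i) = w at *
    generalize √(x i) = a at *
    generalize √(y i) = b at *
    rw [← hu2, ← hx2, ← hy2]
    have hG : 0 ≤ η * γ i := mul_nonneg hη.le (hγ i)
    -- Three-point identity, and completion of the square after `a² - b² ≤ 2 a (a - b)`.
    have hid : (w - a) ^ 2 / a + η ^ 2 * (γ i ^ 2 * (a ^ 2 * a))
        - (η * (γ i * (a ^ 2 - w ^ 2)) + (w - b) ^ 2 / b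
          + (η * γ i + 1 / a - 1 / b) * (w ^ 2 - b ^ 2))
        = η * γ i * (a - b) ^ 2 + ((a - b) - η * γ i * a ^ 2) ^ 2 / a := by
      field_simp
      ring
    have hnn : 0 ≤ η * γ i * (a - b) ^ 2 + ((a - b) - η * γ i * a ^ 2) ^ 2 / a := by positivity
    linarith
  have hsum := Finset.sum_le_sum fun i (_ : i ∈ Finset.univ) => hterm i
  simp only [Finset.sum_add_distrib, ← Finset.mul_sum] at hsum
  unfold bregman
  linarith

/-! ### The pathwise regret bound -/

theorem predict_pos_and_mem (hd : 0 < d) (η : ℝ) (g : ℕ → Fin d → ℝ) (a : ℕ → Fin d) (t : ℕ) :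
    (∀ i, 0 < predict (1 / 2) η g a t i) ∧
      predict (1 / 2) η g a t ∈ stdSimplex ℝ (Fin d) := by
  have hd' : (0 : ℝ) < d := Nat.cast_pos.mpr hd
  induction t with
  | zero =>
    refine ⟨fun i => one_div_pos.mpr hd', fun i => (one_div_pos.mpr hd').le, ?_⟩
    simp [predict, hd'.ne']
  | succ t ih =>
    have h := update_spec hd (q := 1 / 2) (by norm_num) η (predict (1 / 2) η g a t)
      (lossEstimate (predict (1 / 2) η g a t) (a t) (g t (a t)))
    exact ⟨h.pos ih.1 ih.2, h.1⟩

theorem bregman_predict_zero_le (hd : 0 < d) (η : ℝ) (g : ℕ → Fin d → ℝ) (a : ℕ → Fin d)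
    {u : Fin d → ℝ} (hu : u ∈ stdSimplex ℝ (Fin d)) :
    bregman u (predict (1 / 2) η g a 0) ≤ 2 * √(d : ℝ) := by
  have hd' : (0 : ℝ) < d := Nat.cast_pos.mpr hd
  have hs : 0 < √(d : ℝ) := Real.sqrt_pos.mpr hd'
  have hs2 := Real.sq_sqrt hd'.le
  have hterm : ∀ i, (√(u i) - √(1 / (d : ℝ))) ^ 2 / √(1 / (d : ℝ)) ≤
      √(d : ℝ) * u i + 1 / √(d : ℝ) := by
    intro i
    have hu2 := Real.sq_sqrt (hu.1 i)
    have hu0 := Real.sqrt_nonneg (u i)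
    rw [Real.sqrt_div zero_le_one, Real.sqrt_one]
    have hid : (√(u i) - 1 / √(d : ℝ)) ^ 2 / (1 / √(d : ℝ)) =
        √(d : ℝ) * √(u i) ^ 2 + 1 / √(d : ℝ) - 2 * √(u i) := by
      field_simp
      ring
    rw [hid, hu2]
    linarith
  calc bregman u (predict (1 / 2) η g a 0)
      ≤ ∑ i, (√(d : ℝ) * u i + 1 / √(d : ℝ)) := Finset.sum_le_sum fun i _ => hterm i
    _ = √(d : ℝ) + d * (1 / √(d : ℝ)) := by
        rw [Finset.sum_add_distrib, ← Finset.mul_sum, hu.2]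
        simp
    _ = 2 * √(d : ℝ) := by
        nth_rewrite 2 [← hs2]
        field_simp
        ring

/-- The part of the pathwise regret bound contributed by pulling arm `i` in round `t`: the estimated
loss of the comparator `u`, plus the second-order term of mirror descent. -/
def roundBound (η : ℝ) (g : ℕ → Fin d → ℝ) (u : Fin d → ℝ) (t : ℕ) (a : ℕ → Fin d) (i : Fin d) :
    ℝ :=
  g t i * u i / predict (1 / 2) η g a t i + η * (g t i ^ 2 / √(predict (1 / 2) η g a t i))

/-- Regret bound against the estimated losses, for an arbitrary sequence of arms. -/
theorem sum_loss_le (hd : 0 < d) {η : ℝ} (hη : 0 < η) {T : ℕ} {g : ℕ → Fin d → ℝ}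
    (hg : ∀ t < T, ∀ i, 0 ≤ g t i) {u : Fin d → ℝ} (hu : u ∈ stdSimplex ℝ (Fin d))
    (a : ℕ → Fin d) :
    ∑ t ∈ Finset.range T, g t (a t) ≤
      2 * √(d : ℝ) / η + ∑ t ∈ Finset.range T, roundBound η g u t a (a t) := by
  set x := predict (1 / 2) η g a
  have hstep : ∀ t < T, η * g t (a t) + bregman u (x (t + 1)) ≤
      bregman u (x t) + η * roundBound η g u t a (a t) := by
    intro t ht
    obtain ⟨hpos, hmem⟩ := predict_pos_and_mem hd η g a t
    have hup := update_spec hd (q := 1 / 2) (by norm_num) η (x t)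
      (lossEstimate (x t) (a t) (g t (a t)))
    have hγ : ∀ i, 0 ≤ lossEstimate (x t) (a t) (g t (a t)) i := by
      intro i
      unfold lossEstimate
      split_ifs
      · exact div_nonneg (hg t ht _) (hpos i).le
      · exact le_rfl
    have h := hup.regret_le hη hpos hmem hγ hu
    have e1 : ∑ i, lossEstimate (x t) (a t) (g t (a t)) i * (x t i - u i) =
        g t (a t) - g t (a t) * u (a t) / x t (a t) := by
      rw [Finset.sum_eq_single (a t) (fun j _ hj => by simp [lossEstimate, hj]) (by simp)]
      have hne : x t (a t) ≠ 0 := (hpos (a t)).ne'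
      simp only [lossEstimate, if_true]
      change g t (a t) / x t (a t) * (x t (a t) - u (a t)) = _
      field_simp
    have e2 : ∑ i, lossEstimate (x t) (a t) (g t (a t)) i ^ 2 * (x t i * √(x t i)) =
        g t (a t) ^ 2 / √(x t (a t)) := by
      rw [Finset.sum_eq_single (a t) (fun j _ hj => by simp [lossEstimate, hj]) (by simp)]
      have hs := Real.sqrt_pos.mpr (hpos (a t))
      have hs2 := Real.sq_sqrt (hpos (a t)).le
      simp only [lossEstimate, if_true]
      change 0 < √(x t (a t)) at hs
      change √(x t (a t)) ^ 2 = x t (a t) at hs2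
      generalize √(x t (a t)) = s at *
      rw [← hs2]
      field_simp
    rw [e1, e2] at h
    change _ + bregman u (x (t + 1)) ≤ _ at h
    have e3 : roundBound η g u t a (a t) =
      g t (a t) * u (a t) / x t (a t) + η * (g t (a t) ^ 2 / √(x t (a t))) := rfl
    rw [e3]
    linarith
  have htel : ∀ n ≤ T, η * ∑ t ∈ Finset.range n, g t (a t) + bregman u (x n) ≤
      bregman u (x 0) + η * ∑ t ∈ Finset.range n, roundBound η g u t a (a t) := by
    intro n
    induction n with
    | zero => simp
    | succ n ih =>
      intro hn
      rw [Finset.sum_range_succ, Finset.sum_range_succ]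
      have h1 := ih (by omega)
      have h2 := hstep n (by omega)
      linarith
  have h1 := htel T le_rfl
  have h2 := bregman_predict_zero_le hd η g a hu
  have h3 := bregman_nonneg u (x T)
  have h4 : η * (2 * √(d : ℝ) / η) = 2 * √(d : ℝ) := by field_simp
  change bregman u (x 0) ≤ _ at h2
  refine le_of_mul_le_mul_left ?_ hη
  rw [mul_add, h4]
  linarith

/-! ### Conditioning on the past arms -/

/-- Predictions use only the past arms. -/
theorem dependsOn_predict (q η : ℝ) (g : ℕ → Fin d → ℝ) (t : ℕ) :
    DependsOn (fun a => predict q η g a t) (Set.Iio t) := by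
  intro a b hab
  induction t with
  | zero => rfl
  | succ t ih =>
    have h1 : predict q η g a t = predict q η g b t :=
      ih fun s hs => hab s (Nat.lt_succ_of_lt hs)
    have h2 : a t = b t := hab t (Nat.lt_succ_self t)
    simp only [predict, h1, h2]

theorem past_le {Ω : Type*} [m : MeasurableSpace Ω] {A : ℕ → Ω → Fin d} {t : ℕ}
    (hA : ∀ s < t, Measurable (A s)) : past A t ≤ m :=
  iSup₂_le fun s hs => (hA s (Finset.mem_range.mp hs)).comap_le

/-- A function of the first `t` arms is a function of a random variable with finitely many values,
hence measurable with respect to the past and bounded. -/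
theorem measurable_bounded_of_dependsOn {Ω : Type*} [MeasurableSpace Ω] (A : ℕ → Ω → Fin d)
    {t : ℕ} {f : (ℕ → Fin d) → ℝ} (hf : DependsOn f (Set.Iio t)) :
    Measurable[past A t] (fun ω => f fun s => A s ω) ∧
      ∃ C, ∀ ω, ‖f fun s => A s ω‖ ≤ C := by
  rcases isEmpty_or_nonempty Ω with hΩ | ⟨⟨ω₀⟩⟩
  · exact ⟨@measurable_of_empty Ω ℝ (past A t) _ _ _, 0, fun ω => hΩ.elim ω⟩
  -- An arbitrary arm, used to continue the first `t` arms to an infinite sequence.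
  have a₀ : Fin d := A 0 ω₀
  let F : (Fin t → Fin d) → ℝ := fun v => f fun s => if h : s < t then v ⟨s, h⟩ else a₀
  have hF : ∀ ω, (f fun s => A s ω) = F fun s => A s ω := by
    intro ω
    refine hf fun s hs => ?_
    have hs' : s < t := hs
    simp [hs']
  simp only [hF]
  constructor
  · have hm : Measurable[past A t] fun ω => (fun s : Fin t => A s ω) := by
      refine @measurable_pi_lambda _ _ _ (past A t) _ _ fun s => ?_
      have hle : MeasurableSpace.comap (A s) inferInstance ≤ past A t :=
        le_iSup₂_of_le (s : ℕ) (Finset.mem_range.mpr s.2) le_rfl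
      exact (comap_measurable (A s)).mono hle le_rfl
    exact (measurable_of_countable F).comp hm
  · obtain ⟨C, hC⟩ := (Set.finite_range fun v => ‖F v‖).bddAbove
    exact ⟨C, fun ω => hC ⟨fun s => A s ω, rfl⟩⟩

theorem integrable_of_dependsOn {Ω : Type*} [MeasurableSpace Ω] {μ : Measure Ω}
    [IsFiniteMeasure μ] {A : ℕ → Ω → Fin d} {t : ℕ} (hA : ∀ s < t, Measurable (A s))
    {f : (ℕ → Fin d) → ℝ} (hf : DependsOn f (Set.Iio t)) :
    Integrable (fun ω => f fun s => A s ω) μ := by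
  obtain ⟨hm, C, hC⟩ := measurable_bounded_of_dependsOn A hf
  exact Integrable.of_bound (hm.mono (past_le hA) le_rfl).aestronglyMeasurable C
    (Filter.Eventually.of_forall hC)

/-- Averaging over the arm of round `t`, conditionally on the past. -/
theorem IsRun.integral_eq {Ω : Type*} [MeasurableSpace Ω] {μ : Measure Ω}
    [IsProbabilityMeasure μ] {q η : ℝ} {g : ℕ → Fin d → ℝ} {T : ℕ} {A : ℕ → Ω → Fin d}
    (hA : IsRun μ q η g T A) {t : ℕ} (ht : t < T) {H : (ℕ → Fin d) → Fin d → ℝ}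
    (hH : DependsOn H (Set.Iio t)) :
    ∫ ω, H (fun s => A s ω) (A t ω) ∂μ =
      ∫ ω, ∑ i, predict q η g (fun s => A s ω) t i * H (fun s => A s ω) i ∂μ := by
  have hAt : ∀ s < t, Measurable (A s) := fun s hs => hA.measurable s (hs.trans ht)
  have hpast := past_le hAt
  have hHi : ∀ i, DependsOn (fun a => H a i) (Set.Iio t) :=
    fun i a b hab => congrFun (hH hab) i
  have hPi : ∀ i, DependsOn (fun a => predict q η g a t i * H a i) (Set.Iio t) :=
    fun i a b hab => congrArg₂ (· * ·) (congrFun (dependsOn_predict q η g t hab) i) (hHi i hab)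
  have hset : ∀ i, MeasurableSet (A t ⁻¹' {i}) :=
    fun i => hA.measurable t ht (measurableSet_singleton i)
  have hind : ∀ i, Integrable ((A t ⁻¹' {i}).indicator fun _ => (1 : ℝ)) μ :=
    fun i => (integrable_const 1).indicator (hset i)
  have hprod : ∀ i, Integrable
      ((A t ⁻¹' {i}).indicator (fun _ => (1 : ℝ)) * fun ω => H (fun s => A s ω) i) μ := by
    intro i
    obtain ⟨hm, C, hC⟩ := measurable_bounded_of_dependsOn A (hHi i)
    exact (hind i).mul_bdd (c := C) (hm.mono hpast le_rfl).aestronglyMeasurable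
      (Filter.Eventually.of_forall hC)
  have hsplit : ∀ ω, H (fun s => A s ω) (A t ω) =
      ∑ i, ((A t ⁻¹' {i}).indicator (fun _ => (1 : ℝ)) * fun ω => H (fun s => A s ω) i) ω := by
    intro ω
    classical
    simp [Set.indicator_apply]
  simp only [hsplit]
  rw [integral_finsetSum _ fun i _ => hprod i,
    integral_finsetSum _ fun i _ => integrable_of_dependsOn hAt (hPi i)]
  refine Finset.sum_congr rfl fun i _ => ?_
  rw [← integral_condExp hpast]
  have hm : StronglyMeasurable[past A t] fun ω => H (fun s => A s ω) i :=
    (measurable_bounded_of_dependsOn A (hHi i)).1.stronglyMeasurable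
  refine integral_congr_ae ?_
  filter_upwards [condExp_mul_of_stronglyMeasurable_right hm (hprod i) (hind i),
    hA.draw t ht i] with ω h1 h2
  rw [h1, Pi.mul_apply]
  exact congrArg (· * _) h2

/-! ### The expected regret -/

theorem sum_sqrt_le {x : Fin d → ℝ} (hx : x ∈ stdSimplex ℝ (Fin d)) :
    ∑ i, √(x i) ≤ √(d : ℝ) := by
  apply Real.le_sqrt_of_sq_le
  have h := sq_sum_le_card_mul_sum_sq (s := Finset.univ) (f := fun i => √(x i))
  simp only [Real.sq_sqrt (hx.1 _), hx.2, Finset.card_univ, Fintype.card_fin, mul_one] at h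
  exact h

theorem sum_predict_mul_roundBound_le (hd : 0 < d) {η L : ℝ} (hη : 0 < η) {g : ℕ → Fin d → ℝ}
    {t : ℕ} (hg : ∀ i, g t i ∈ Set.Icc 0 L) (u : Fin d → ℝ) (a : ℕ → Fin d) :
    ∑ i, predict (1 / 2) η g a t i * roundBound η g u t a i ≤
      ∑ i, g t i * u i + η * √(d : ℝ) * L ^ 2 := by
  obtain ⟨hpos, hmem⟩ := predict_pos_and_mem hd η g a t
  unfold roundBound
  set x := predict (1 / 2) η g a t
  have hterm : ∀ i, x i * (g t i * u i / x i + η * (g t i ^ 2 / √(x i))) ≤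
      g t i * u i + η * L ^ 2 * √(x i) := by
    intro i
    have hs := Real.sqrt_pos.mpr (hpos i)
    have hs2 := Real.sq_sqrt (hpos i).le
    have hsq : g t i ^ 2 ≤ L ^ 2 := pow_le_pow_left₀ (hg i).1 (hg i).2 2
    have hid : x i * (g t i * u i / x i + η * (g t i ^ 2 / √(x i))) =
        g t i * u i + η * g t i ^ 2 * √(x i) := by
      generalize √(x i) = s at *
      rw [← hs2]
      field_simp
    rw [hid]
    gcongr
  calc _ ≤ ∑ i, (g t i * u i + η * L ^ 2 * √(x i)) := Finset.sum_le_sum fun i _ => hterm i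
    _ = ∑ i, g t i * u i + η * L ^ 2 * ∑ i, √(x i) := by
        rw [Finset.sum_add_distrib, ← Finset.mul_sum]
    _ ≤ ∑ i, g t i * u i + η * L ^ 2 * √(d : ℝ) := by
        gcongr
        exact sum_sqrt_le hmem
    _ = _ := by ring

theorem IsRun.expectedRegret_le {Ω : Type*} [MeasurableSpace Ω] {μ : Measure Ω}
    [IsProbabilityMeasure μ] {T : ℕ} {L η : ℝ} (hη : 0 < η) {g : ℕ → Fin d → ℝ}
    (hg : ∀ t < T, ∀ i, g t i ∈ Set.Icc 0 L) {A : ℕ → Ω → Fin d}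
    (hA : IsRun μ (1 / 2) η g T A) {u : Fin d → ℝ} (hu : u ∈ stdSimplex ℝ (Fin d)) :
    expectedRegret μ g T A u ≤ 2 * √(d : ℝ) / η + η * √(d : ℝ) * L ^ 2 * T := by
  have hd : 0 < d := by
    obtain ⟨ω⟩ := nonempty_of_isProbabilityMeasure μ
    exact (A 0 ω).pos
  have hmeas : ∀ t < T, ∀ s < t + 1, Measurable (A s) := fun t ht s hs =>
    hA.measurable s (by omega)
  have hRdep : ∀ t, DependsOn (roundBound η g u t) (Set.Iio t) := fun t a b hab => by
    have := dependsOn_predict (1 / 2) η g t hab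
    funext i
    simp only [roundBound, this]
  have hlossInt : ∀ t ∈ Finset.range T, Integrable (fun ω => g t (A t ω)) μ := fun t ht =>
    integrable_of_dependsOn (hmeas t (Finset.mem_range.mp ht)) (f := fun a => g t (a t))
      fun a b hab => congrArg (g t) (hab t (Nat.lt_succ_self t))
  have hRInt : ∀ t ∈ Finset.range T,
      Integrable (fun ω => roundBound η g u t (fun s => A s ω) (A t ω)) μ := fun t ht =>
    integrable_of_dependsOn (hmeas t (Finset.mem_range.mp ht))
      (f := fun a => roundBound η g u t a (a t)) fun a b hab => by
        have h1 : a t = b t := hab t (Nat.lt_succ_self t)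
        have h2 := hRdep t fun s hs => hab s (Nat.lt_succ_of_lt hs)
        simp only [h1, h2]
  have hRle : ∀ t ∈ Finset.range T,
      ∫ ω, roundBound η g u t (fun s => A s ω) (A t ω) ∂μ ≤
        ∑ i, g t i * u i + η * √(d : ℝ) * L ^ 2 := by
    intro t ht
    have ht' := Finset.mem_range.mp ht
    rw [hA.integral_eq ht' (hRdep t)]
    have hint : Integrable (fun ω => ∑ i, predict (1 / 2) η g (fun s => A s ω) t i *
        roundBound η g u t (fun s => A s ω) i) μ :=
      integrable_of_dependsOn (t := t) (fun s hs => hA.measurable s (hs.trans ht'))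
        (f := fun a => ∑ i, predict (1 / 2) η g a t i * roundBound η g u t a i)
        fun a b hab => by
          have h1 := dependsOn_predict (1 / 2) η g t hab
          have h2 := hRdep t hab
          simp only at h1
          simp only [h1, h2]
    have h := integral_mono hint (integrable_const (∑ i, g t i * u i + η * √(d : ℝ) * L ^ 2))
      fun ω => sum_predict_mul_roundBound_le hd hη (hg t ht') u fun s => A s ω
    simpa using h
  have hpath : ∫ ω, ∑ t ∈ Finset.range T, g t (A t ω) ∂μ ≤
      ∫ ω, (2 * √(d : ℝ) / η +
        ∑ t ∈ Finset.range T, roundBound η g u t (fun s => A s ω) (A t ω)) ∂μ :=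
    integral_mono (integrable_finsetSum _ hlossInt)
      ((integrable_const _).add (integrable_finsetSum _ hRInt))
      fun ω => sum_loss_le hd hη (fun t ht i => (hg t ht i).1) hu fun s => A s ω
  rw [integral_add (integrable_const _) (integrable_finsetSum _ hRInt),
    integral_finsetSum _ hRInt] at hpath
  have hsum := Finset.sum_le_sum hRle
  rw [Finset.sum_add_distrib] at hsum
  simp only [integral_const, probReal_univ, one_smul, Finset.sum_const, Finset.card_range,
    nsmul_eq_mul] at hpath hsum
  unfold expectedRegret
  linarith

end INF

end

theorem mainTheorem11 {Ω : Type*} [MeasurableSpace Ω] (μ : Measure Ω) [IsProbabilityMeasure μ]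
    (d T : ℕ) (L η : ℝ) (hη : 0 < η)
    (g : ℕ → Fin d → ℝ) (hg : ∀ t < T, ∀ i, g t i ∈ Set.Icc 0 L)
    (A : ℕ → Ω → Fin d) (hA : INF.IsRun μ (1 / 2) η g T A)
    (u : Fin d → ℝ) (hu : u ∈ stdSimplex ℝ (Fin d)) :
    INF.expectedRegret μ g T A u ≤ 2 * √(d : ℝ) / η + η * √(d : ℝ) * L ^ 2 * T ∧
      ∀ c : ℝ, 0 < c → 0 < L → 0 < T → η = c / (L * √(T : ℝ)) →
        INF.expectedRegret μ g T A u ≤ (2 / c + c) * (L * √((d : ℝ) * T)) := by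
  have hmain := hA.expectedRegret_le hη hg hu
  refine ⟨hmain, fun c hc hL hT hηc => hmain.trans_eq ?_⟩
  have hs : 0 < √(T : ℝ) := Real.sqrt_pos.mpr (Nat.cast_pos.mpr hT)
  have hs2 : √(T : ℝ) ^ 2 = T := Real.sq_sqrt (Nat.cast_nonneg T)
  rw [Real.sqrt_mul (Nat.cast_nonneg d), hηc]
  generalize √(T : ℝ) = s at *
  rw [← hs2]
  field_simp
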